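/- Let $(X,d,\nu)$ be a computable metric space, i.e. a metric space with a sequence $\nu:\mathbb N\to X$ of dense range such that the real double sequence $(a,b)\mapsto d(\nu(a),\nu(b))$ is computable, and let $N\in\mathbb N$. Let $\Sigma^0_1(X)$ and $\Pi^0_1(X)$ be the classes of open and of closed subsets of $X$. A name of an open set $U$ is any $p\in\mathbb N^{\mathbb N}$ with $U=\bigcup\{\alpha(p_i-1) : i\in\mathbb N,\ p_i\ge 1\}$, where $\alpha\langle a,r\rangle$ is the open ball with centre $\nu(a)$ and radius the $r$-th positive rational (in a standard numbering of the positive rationals). A name of a closed set is a name of its complement. A name of an $n$-tuple ($n$ fixed) is $\langle p^{(0)},\dots,p^{(n-1)}\rangle$ with $p^{(i)}$ a name of the $i$-th entry. A name of a finite word $(s_i)_{i<k}$ of arbitrary length $k$ is $k.\langle p^{(0)},p^{(1)},\dots\rangle$ with $p^{(i)}$ a name of $s_i$ for each $i<k$. The sets of all such words over $\Sigma^0_1(X)$ and of all $n$-tuples over $\Sigma^0_1(X)$ and $\Pi^0_1(X)$ are written $\Sigma^0_1(X)^*$, $\Sigma^0_1(X)^n$, $\Pi^0_1(X)^n$. A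 multi-valued operation $f$ with given domain $\operatorname{dom} f$ is computable if there is a computable partial function $F:\subseteq\mathbb N^{\mathbb N}\to\mathbb N^{\mathbb N}$ such that, for every name $p$ of every $s\in\operatorname{dom} f$, $F(p)$ is defined and is a name of some element of $f(s)$ (in particular $f(s)\neq\emptyset$). The order of a family $(A_i)_{i\in I}$ of subsets of $X$ is the least $n\in\mathbb N$ such that $\bigcap_{j\le n}A_{i_j}=\emptyset$ whenever $i_0,\dots,i_n\in I$ are distinct ($\infty$ if there is none). Then the following are equivalent: 1. The operation $C^*$ is computable, where $C^*:\subseteq\Sigma^0_1(X)^*\rightrightarrows\Sigma^0_1(X)^*$ has domain $\{(U_i)_{i<k} : \bigcup_{i<k}U_i=X\}$, and $C^*((U_i)_{i<k})$ is the set of all $(W_i)_{i<k}\in\Sigma^0_1(X)^*$ with $W_i\subseteq U_i$ for all $i<k$, $\bigcup_{i<k} W_i=X$ and $(W_i)_{i<k}$ of order at most $N+1$. 2. The operation $C$ is computable, where $C:\subseteq\Sigma^0_1(X)^{N+2}\rightrightarrows\Sigma^0_1(X)^{N+2}$ has domain $\{(U_i)_{i\le N+1} : \bigcup_i U_i=X\}$,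 and $C((U_i)_{i\le N+1})$ is the set of all $(W_i)_{i\le N+1}\in\Sigma^0_1(X)^{N+2}$ with $W_i\subseteq U_i$ for all $i$, $\bigcup_i W_i=X$ and $\bigcap_i W_i=\emptyset$. 3. The operation $D$ is computable, where $D:\subseteq\Pi^0_1(X)^{N+2}\rightrightarrows\Pi^0_1(X)^{N+2}$ has domain $\{(B_i)_{i\le N+1} : \bigcap_i B_i=\emptyset\}$, and $D((B_i)_{i\le N+1})$ is the set of all $(F_i)_{i\le N+1}\in\Pi^0_1(X)^{N+2}$ with $B_i\subseteq F_i$ for all $i$, $\bigcup_i F_i=X$ and $\bigcap_i F_i=\emptyset$. -/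

import Mathlib

/-! Computable analysis on Baire space, hyperspaces of open and closed sets of a computable
metric space, and the covering operations. -/

namespace CovDim

/-- Baire space `ℕ^ℕ`. -/
abbrev Baire : Type := ℕ → ℕ

/-- The initial segment `p 0, …, p (n - 1)` of `p`. -/
def initSeg (p : Baire) (n : ℕ) : List ℕ := (List.range n).map p

/-- Computability of a partial function `F` on Baire space: `F` is induced by a computable
word function `h` that is monotone for the prefix order. That is, `F p = q` iff the words
`h (initSeg p m)` exhaust `q`; and `F p` is undefined iff these words have bounded length.
(This is the usual description of the functions computed by Type-2 machines.) -/
def ComputableFun (F : Baire →. Baire) : Prop :=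
  ∃ h : List ℕ → List ℕ, Computable h ∧ (∀ u v : List ℕ, u <+: v → h u <+: h v) ∧
    ∀ p q : Baire, q ∈ F p ↔ ∀ n : ℕ, ∃ m : ℕ, initSeg q n <+: h (initSeg p m)

/-- A representation of `S`: a surjective partial function from Baire space onto `S`. -/
structure Representation (S : Type*) where
  /-- the partial naming function -/
  toFun : Baire →. S
  surj : ∀ s : S, ∃ p : Baire, s ∈ toFun p

/-- An operation, that is, a partial multi-valued function with an explicitly given domain.
The value at a point of the domain is allowed to be empty (such an operation has no
realiser if the point has a name). -/
structure Operation (S T : Type*) where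
  /-- the domain -/
  dom : Set S
  /-- the set of admissible values -/
  val : S → Set T

/-- `F` is a `(δ, δ')`-realiser of `f`. -/
def IsRealiser {S T : Type*} (δ : Representation S) (δ' : Representation T)
    (F : Baire →. Baire) (f : Operation S T) : Prop :=
  ∀ (p : Baire) (s : S), s ∈ δ.toFun p → s ∈ f.dom →
    ∃ q ∈ F p, ∃ t ∈ δ'.toFun q, t ∈ f.val s

/-- `f` is `(δ, δ')`-computable. -/
def IsComputable {S T : Type*} (δ : Representation S) (δ' : Representation T)
    (f : Operation S T) : Prop :=
  ∃ F : Baire →. Baire, ComputableFun F ∧ IsRealiser δ δ' F f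

/-! ### Finite powers and finite words -/

/-- The `i`-th component of `p = ⟨p⁰, …, pⁿ⁻¹⟩`, where `p (n * j + i) = pⁱ j`. -/
def finComp (n : ℕ) (p : Baire) (i : Fin n) : Baire := fun j => p (n * j + i)

/-- The `i`-th component of `p = ⟨p⁰, p¹, …⟩`, where `p ⟨i, j⟩ = pⁱ j`. -/
def seqComp (p : Baire) (i : ℕ) : Baire := fun j => p (Nat.pair i j)

/-- The representation `δⁿ` of `Sⁿ`. -/
def Representation.pow {S : Type*} (δ : Representation S) (n : ℕ) :
    Representation (Fin n → S) where
  toFun p :=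
    { Dom := ∀ i : Fin n, (δ.toFun (finComp n p i)).Dom
      get := fun h i => (δ.toFun (finComp n p i)).get (h i) }
  surj s := by
    choose q hq using fun i => δ.surj (s i)
    have key : ∀ i : Fin n, finComp n
        (fun k => if h : 0 < n then q ⟨k % n, Nat.mod_lt _ h⟩ (k / n) else 0) i = q i := by
      intro i
      have hn : 0 < n := i.pos
      funext j
      have h1 : (n * j + (i : ℕ)) % n = i := by
        rw [Nat.mul_add_mod, Nat.mod_eq_of_lt i.isLt]
      have h2 : (n * j + (i : ℕ)) / n = j := by
        rw [Nat.mul_add_div hn, Nat.div_eq_of_lt i.isLt, add_zero]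
      simp [finComp, hn, h1, h2]
    refine ⟨fun k => if h : 0 < n then q ⟨k % n, Nat.mod_lt _ h⟩ (k / n) else 0,
      fun i => ?_, ?_⟩
    · rw [key i]
      exact (hq i).1
    · funext i
      have h3 := hq i
      rw [← key i] at h3
      exact h3.2

/-- Finite words `(sᵢ)_{i < k}` over `S`. -/
abbrev Words (S : Type*) : Type _ := Σ k : ℕ, (Fin k → S)

/-- The representation `δ*` of finite words: a name `k.⟨p⁰, p¹, …⟩` consists of the length `k`
followed by a sequence of which the first `k` components name the letters. -/
def Representation.star {S : Type*} (δ : Representation S) : Representation (Words S) where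
  toFun p :=
    { Dom := ∀ i : Fin (p 0), (δ.toFun (seqComp (fun j => p (j + 1)) i)).Dom
      get := fun h => ⟨p 0, fun i => (δ.toFun (seqComp (fun j => p (j + 1)) i)).get (h i)⟩ }
  surj s := by
    obtain ⟨k, s⟩ := s
    choose q hq using fun i => δ.surj (s i)
    let p : Baire := fun m => match m with
      | 0 => k
      | m + 1 => if h : m.unpair.1 < k then q ⟨m.unpair.1, h⟩ m.unpair.2 else 0
    have key : ∀ i : Fin k, seqComp (fun j => p (j + 1)) i = q i := by
      intro i
      funext j
      simp [seqComp, p]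
    refine ⟨p, fun i => ?_, ?_⟩
    · rw [key i]
      exact (hq i).1
    · change (⟨k, _⟩ : Words S) = ⟨k, s⟩
      congr 1
      funext i
      have h3 := hq i
      rw [← key i] at h3
      exact h3.2

/-! ### Computable metric spaces and their hyperspaces -/

/-- A computable metric space `(X, d, ν)`: the sequence `ν` is dense and the real double
sequence `d (ν a) (ν b)` is computable, i.e. rational approximations of it with error at
most `2⁻ᵏ` can be computed from `a`, `b`, `k`. -/
class ComputableMetricSpace (X : Type*) extends MetricSpace X where
  /-- the dense sequence -/
  ν : ℕ → X
  dense : DenseRange ν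
  dist_computable : ∃ f : ℕ × ℕ × ℕ → ℕ × ℕ, Computable f ∧ ∀ a b k : ℕ,
    |dist (ν a) (ν b) - ((f (a, b, k)).1 : ℝ) / (((f (a, b, k)).2 : ℝ) + 1)| ≤ (1 / 2 : ℝ) ^ k

/-- A total numbering of the positive rationals. -/
def posRat (r : ℕ) : ℚ := ((r.unpair.1 : ℚ) + 1) / ((r.unpair.2 : ℚ) + 1)

section Hyperspaces

open TopologicalSpace (Opens Closeds)

variable (X : Type*) [ComputableMetricSpace X]

/-- The numbering of ideal open balls: `⟨a, r⟩` is the code of the ball about `ν a` of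
radius the `r`-th positive rational. -/
def idealBall (n : ℕ) : Opens X :=
  ⟨Metric.ball (ComputableMetricSpace.ν n.unpair.1) (posRat n.unpair.2 : ℝ), Metric.isOpen_ball⟩

/-- The open set named by `p`: the union of the ideal balls with code `p i - 1`, over the `i`
with `p i ≥ 1`. -/
def openOf (p : Baire) : Opens X := ⨆ (i : ℕ) (_ : 1 ≤ p i), idealBall X (p i - 1)

theorem openOf_surj (U : Opens X) : ∃ p : Baire, openOf X p = U := by
  classical
  refine ⟨fun n => if idealBall X n ≤ U then n + 1 else 0, le_antisymm ?_ ?_⟩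
  · refine iSup₂_le fun i hi => ?_
    by_cases h : idealBall X i ≤ U
    · simp [h]
    · simp [h] at hi
  · intro x hx
    obtain ⟨ε, hε, hball⟩ := Metric.isOpen_iff.1 U.isOpen x hx
    obtain ⟨b, hb⟩ := exists_nat_one_div_lt (half_pos hε)
    have hb0 : (0 : ℝ) < 1 / ((b : ℝ) + 1) := by positivity
    obtain ⟨a, ha⟩ := (ComputableMetricSpace.dense (X := X)).exists_dist_lt x hb0
    have hcode : ((posRat (Nat.pair 0 b) : ℚ) : ℝ) = 1 / ((b : ℝ) + 1) := by
      simp [posRat]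
    have hmem : x ∈ idealBall X (Nat.pair a (Nat.pair 0 b)) := by
      change x ∈ Metric.ball _ _
      rw [Nat.unpair_pair, hcode]
      exact ha
    have hle : idealBall X (Nat.pair a (Nat.pair 0 b)) ≤ U := by
      intro y hy
      change y ∈ Metric.ball _ _ at hy
      rw [Nat.unpair_pair, hcode, Metric.mem_ball] at hy
      apply hball
      rw [Metric.mem_ball]
      have h1 := dist_triangle_right y x (ComputableMetricSpace.ν (X := X) a)
      linarith
    rw [openOf, Opens.mem_iSup]
    refine ⟨Nat.pair a (Nat.pair 0 b), ?_⟩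
    simpa [hle] using hmem

/-- The representation of the hyperspace `Σ⁰₁(X)` of open sets. -/
def openRep : Representation (Opens X) where
  toFun p := Part.some (openOf X p)
  surj U := by
    obtain ⟨p, hp⟩ := openOf_surj X U
    exact ⟨p, by simp [hp]⟩

/-- The representation of the hyperspace `Π⁰₁(X)` of closed sets: a name of a closed set is
a name of its complement. -/
def closedRep : Representation (Closeds X) where
  toFun p := Part.some (openOf X p).compl
  surj A := by
    obtain ⟨p, hp⟩ := openOf_surj X A.compl
    refine ⟨p, Part.mem_some_iff.2 ?_⟩
    rw [hp, Closeds.compl_compl]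

end Hyperspaces

/-! ### Covers, order, and the covering operations -/

/-- The order of an indexed family: the least `n` such that `A (i 0) ∩ … ∩ A (i n) = ∅` for all
pairwise distinct indices `i 0, …, i n` (and `∞` if there is no such `n`). -/
noncomputable def order {X I : Type*} (A : I → Set X) : ℕ∞ :=
  ⨅ (n : ℕ) (_ : ∀ i : Fin (n + 1) → I, Function.Injective i → ⋂ j, A (i j) = ∅), (n : ℕ∞)

/-- `A` covers the space. -/
def IsCover {X I : Type*} (A : I → Set X) : Prop := ⋃ i, A i = Set.univ

/-- `B` is a shrinking of the cover `A`: a cover with the same index set and `B i ⊆ A i`. -/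
def IsShrinking {X I : Type*} (A B : I → Set X) : Prop :=
  (∀ i, B i ⊆ A i) ∧ IsCover B

section Operations

open TopologicalSpace (Opens Closeds)

variable (X : Type*) [ComputableMetricSpace X] (N : ℕ)

/-- The operation `C*`: shrink a finite open cover to an open one of order at most `N + 1`. -/
def opCstar : Operation (Words (Opens X)) (Words (Opens X)) where
  dom := {U | IsCover fun i => (U.2 i : Set X)}
  val U := {W' | ∃ W : Fin U.1 → Opens X, W' = ⟨U.1, W⟩ ∧
    IsShrinking (fun i => (U.2 i : Set X)) (fun i => (W i : Set X)) ∧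
    order (fun i => (W i : Set X)) ≤ N + 1}

/-- The operation `C`: shrink an open cover with `N + 2` members to an open one whose members
have empty intersection. -/
def opC : Operation (Fin (N + 2) → Opens X) (Fin (N + 2) → Opens X) where
  dom := {U | ⋃ i, (U i : Set X) = Set.univ}
  val U := {W | (∀ i, (W i : Set X) ⊆ U i) ∧ ⋃ i, (W i : Set X) = Set.univ ∧
    ⋂ i, (W i : Set X) = ∅}

/-- The operation `D`: enlarge `N + 2` closed sets with empty intersection to closed sets which
still have empty intersection and cover the space. -/
def opD : Operation (Fin (N + 2) → Closeds X) (Fin (N + 2) → Closeds X) where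
  dom := {B | ⋂ i, (B i : Set X) = ∅}
  val B := {F | (∀ i, (B i : Set X) ⊆ F i) ∧ ⋃ i, (F i : Set X) = Set.univ ∧
    ⋂ i, (F i : Set X) = ∅}

end Operations

end CovDim

namespace CovDim

/-! ### Monotone word functions and causal functionals -/

/-! Statements 2 and 3 have the same realisers: closed sets are named through their complements, and
complementation exchanges "covers" with "has empty intersection". For 1 ⇒ 2, treat the `N + 2` sets
as a word; order at most `N + 1` then says that all of them together have no common point.

For 2 ⇒ 1, take a cover `U` of length `k` and a map `g` from its indices to `N + 2` classes. The
unions of the `U i` over the classes form a cover, which `C` shrinks to some `W`. Replace each `U i`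
by `U i ∩ W (g i)`. The result still covers, since a point of `W j` lies in some `U i` with `g i =
j`. Members with indices from all `N + 2` distinct classes now have no common point, and later
shrinking preserves this. After all `(N + 2) ^ k` maps `g` have been treated, any `N + 2` distinct
indices have been separated by some `g`, so the order is at most `N + 1`
(`exists_exhausts_iterWord`).

The iteration is computable because intersections of named open sets are: formal ball inclusion can
be tested and is fine enough (`ApproximatesDist.openOf_meetName`). As the number of steps depends on
the input, stages are composed as monotone word functions, and `Exhausts` follows their limits. -/

/-- A chain of words, increasing for the prefix order, that exhausts the sequence `q`. -/
def Exhausts (u : ℕ → List ℕ) (q : Baire) : Prop :=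
  (∀ m n, m ≤ n → u m <+: u n) ∧ ∀ n, ∃ m, initSeg q n <+: u m

theorem length_initSeg (p : Baire) (n : ℕ) : (initSeg p n).length = n := by
  simp [initSeg]

theorem initSeg_mono (p : Baire) {m n : ℕ} (h : m ≤ n) : initSeg p m <+: initSeg p n :=
  (List.prefix_iff_eq_take.2 (by simp [initSeg, ← List.map_take, List.take_range, h]))

theorem getD_initSeg (p : Baire) {l n : ℕ} (h : l < n) : (initSeg p n).getD l 0 = p l := by
  simp [initSeg, List.getD, h]

theorem initSeg_succ (p : Baire) (n : ℕ) :
    initSeg p (n + 1) = p 0 :: initSeg (fun j => p (j + 1)) n := by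
  simp [initSeg, List.range_succ_eq_map, Function.comp_def]

theorem exhausts_initSeg (p : Baire) : Exhausts (initSeg p) p :=
  ⟨fun _ _ h => initSeg_mono p h, fun n => ⟨n, List.prefix_rfl⟩⟩

theorem Exhausts.unique {u : ℕ → List ℕ} {q q' : Baire} (h : Exhausts u q)
    (h' : Exhausts u q') : q = q' := by
  funext n
  obtain ⟨m, hm⟩ := h.2 (n + 1)
  obtain ⟨m', hm'⟩ := h'.2 (n + 1)
  have e : initSeg q (n + 1) = initSeg q' (n + 1) :=
    (List.prefix_of_prefix_length_le (hm.trans (h.1 _ _ (le_max_left m m')))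
      (hm'.trans (h.1 _ _ (le_max_right m m'))) (by simp [length_initSeg])).eq_of_length
      (by simp [length_initSeg])
  rw [← getD_initSeg q n.lt_succ_self, e, getD_initSeg q' n.lt_succ_self]

/-- Every initial segment of `p` lies below some word of the chain, so the chain may replace the
initial segments as input to `h`. This is what lets stages be composed. -/
theorem Exhausts.comp {h : List ℕ → List ℕ} (hmono : ∀ u v, u <+: v → h u <+: h v)
    {u : ℕ → List ℕ} {p q : Baire} (hu : Exhausts u p)
    (hq : ∀ n, ∃ m, initSeg q n <+: h (initSeg p m)) : Exhausts (fun m => h (u m)) q := by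
  refine ⟨fun m n hmn => hmono _ _ (hu.1 m n hmn), fun n => ?_⟩
  obtain ⟨m, hm⟩ := hq n
  obtain ⟨m', hm'⟩ := hu.2 m
  exact ⟨m', hm.trans (hmono _ _ hm')⟩

/-- Every computable monotone word function induces a computable function on Baire space. -/
theorem exists_computableFun {h : List ℕ → List ℕ} (hc : Computable h)
    (hmono : ∀ u v, u <+: v → h u <+: h v) :
    ∃ F : Baire →. Baire, ComputableFun F ∧
      ∀ p q, Exhausts (fun m => h (initSeg p m)) q → q ∈ F p := by
  have hm : ∀ p m n, m ≤ n → h (initSeg p m) <+: h (initSeg p n) :=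
    fun p m n hmn => hmono _ _ (initSeg_mono p hmn)
  let F : Baire →. Baire := fun p =>
    ⟨∃ q, ∀ n, ∃ m, initSeg q n <+: h (initSeg p m), fun e => e.choose⟩
  have key : ∀ p q, q ∈ F p ↔ ∀ n, ∃ m, initSeg q n <+: h (initSeg p m) := by
    intro p q
    constructor
    · rintro ⟨e, rfl⟩
      exact e.choose_spec
    · intro hq
      refine ⟨⟨q, hq⟩, ?_⟩
      exact Exhausts.unique (u := fun m => h (initSeg p m))
        ⟨hm p, Exists.choose_spec (⟨q, hq⟩ : ∃ q, ∀ n, ∃ m, initSeg q n <+: h (initSeg p m))⟩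
        ⟨hm p, hq⟩
  exact ⟨F, ⟨h, hc, hmono, key⟩, fun p q hq => (key p q).2 hq.2⟩

/-- The output of `Ψ` at `n` depends only on the inputs at the places `≤ n`. -/
def Causal (Ψ : Baire → Baire → Baire) : Prop :=
  ∀ (p p' q q' : Baire) (n : ℕ), (∀ l ≤ n, p l = p' l) → (∀ l ≤ n, q l = q' l) →
    Ψ p q n = Ψ p' q' n

/-- The word function that computes a causal functional. -/
def wordMap (Ψ : Baire → Baire → Baire) (u v : List ℕ) : List ℕ :=
  (List.range (min u.length v.length)).map (Ψ (fun l => u.getD l 0) (fun l => v.getD l 0))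

theorem getD_eq_of_prefix {u v : List ℕ} (h : u <+: v) {l : ℕ} (hl : l < u.length) :
    u.getD l 0 = v.getD l 0 := by
  obtain ⟨t, rfl⟩ := h
  simp [List.getD, List.getElem?_append_left hl]

/-- Entries are produced only at places below both lengths, so by causality the default value of
`getD` is never consulted and longer inputs cannot change them. -/
theorem Causal.wordMap_mono {Ψ : Baire → Baire → Baire} (hΨ : Causal Ψ) {u u' v v' : List ℕ}
    (hu : u <+: u') (hv : v <+: v') : wordMap Ψ u v <+: wordMap Ψ u' v' := by
  have hle := min_le_min hu.length_le hv.length_le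
  have e : wordMap Ψ u v = (wordMap Ψ u' v').take (min u.length v.length) := by
    rw [wordMap, wordMap, ← List.map_take, List.take_range, min_eq_left hle]
    refine List.map_congr_left fun n hn => ?_
    rw [List.mem_range, lt_min_iff] at hn
    exact hΨ _ _ _ _ n (fun l hl => getD_eq_of_prefix hu (hl.trans_lt hn.1))
      (fun l hl => getD_eq_of_prefix hv (hl.trans_lt hn.2))
  rw [e]
  exact List.take_prefix _ _

theorem Causal.wordMap_initSeg {Ψ : Baire → Baire → Baire} (hΨ : Causal Ψ) (p q : Baire)
    (n : ℕ) : wordMap Ψ (initSeg p n) (initSeg q n) = initSeg (Ψ p q) n := by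
  rw [wordMap, length_initSeg, length_initSeg, min_self]
  refine List.map_congr_left fun j hj => ?_
  rw [List.mem_range] at hj
  exact hΨ _ _ _ _ j (fun l hl => getD_initSeg p (hl.trans_lt hj))
    (fun l hl => getD_initSeg q (hl.trans_lt hj))

theorem Causal.exhausts {Ψ : Baire → Baire → Baire} (hΨ : Causal Ψ) {u v : ℕ → List ℕ}
    {p q : Baire} (hu : Exhausts u p) (hv : Exhausts v q) :
    Exhausts (fun m => wordMap Ψ (u m) (v m)) (Ψ p q) := by
  refine ⟨fun m n hmn => hΨ.wordMap_mono (hu.1 m n hmn) (hv.1 m n hmn), fun n => ?_⟩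
  obtain ⟨m, hm⟩ := hu.2 n
  obtain ⟨m', hm'⟩ := hv.2 n
  refine ⟨max m m', ?_⟩
  rw [← hΨ.wordMap_initSeg]
  exact hΨ.wordMap_mono (hm.trans (hu.1 _ _ (le_max_left _ _)))
    (hm'.trans (hv.1 _ _ (le_max_right _ _)))

theorem computable_map_range {α : Type*} [Primcodable α] {f : α → ℕ → ℕ} {b : α → ℕ}
    (hf : Computable₂ f) (hb : Computable b) :
    Computable fun a => (List.range (b a)).map (f a) := by
  -- As `f` is merely computable, the list is built by recursion, one entry at a time.
  have h : Computable fun a => (Nat.rec [] (fun n IH => IH ++ [f a n]) (b a) : List ℕ) :=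
    Computable.nat_rec hb (Computable.const []) (h := fun a y => y.2 ++ [f a y.1])
      (Computable.list_concat.comp (Computable.snd.comp Computable.snd)
        (hf.comp Computable.fst (Computable.fst.comp Computable.snd)))
  refine h.of_eq fun a => ?_
  induction b a with
  | zero => rfl
  | succ n ih => simp only [ih, List.range_succ, List.map_append, List.map_cons, List.map_nil]

theorem computable_wordMap {α : Type*} [Primcodable α] {Ψ : α → Baire → Baire → Baire}
    (h : Computable fun t : (α × List ℕ × List ℕ) × ℕ =>
      Ψ t.1.1 (fun l => t.1.2.1.getD l 0) (fun l => t.1.2.2.getD l 0) t.2) :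
    Computable fun a : α × List ℕ × List ℕ => wordMap (Ψ a.1) a.2.1 a.2.2 :=
  computable_map_range (f := fun (a : α × List ℕ × List ℕ) n =>
      Ψ a.1 (fun l => a.2.1.getD l 0) (fun l => a.2.2.getD l 0) n) h
    (Primrec.nat_min.to_comp.comp
      (Computable.list_length.comp (Computable.fst.comp Computable.snd))
      (Computable.list_length.comp (Computable.snd.comp Computable.snd)))

/-! ### Operations on names of open sets -/

section Names

variable {X : Type*} [ComputableMetricSpace X]

theorem mem_openOf {p : Baire} {x : X} :
    x ∈ openOf X p ↔ ∃ i m, p i = m + 1 ∧ x ∈ idealBall X m := by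
  simp only [openOf, TopologicalSpace.Opens.mem_iSup]
  constructor
  · rintro ⟨i, hi, hx⟩
    exact ⟨i, p i - 1, by omega, hx⟩
  · rintro ⟨i, m, hi, hx⟩
    exact ⟨i, by omega, by simpa [hi] using hx⟩

/-- The name of a word of open sets (without its length) made from the name of a tuple. -/
def tupleToSeq (s : ℕ) (p : Baire) : Baire := fun n =>
  if n.unpair.2 % s = n.unpair.1 then p n.unpair.2 else 0

/-- The name of an `s`-tuple of open sets made from the name of a word. -/
def wordToTuple (s : ℕ) (p : Baire) : Baire := fun n =>
  if 1 ≤ n / s ∧ (n / s - 1).unpair.1 = n % s then p (n / s) else 0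

/-- The name of the `s`-tuple with entries `⋃ {U i | i < k, G i = j}`, made from a name of `U`. -/
def groupName (s k : ℕ) (G : ℕ → ℕ) (p : Baire) : Baire := fun n =>
  if (n / s).unpair.1 < k ∧ G (n / s).unpair.1 = n % s then p (n / s) else 0

theorem mul_add_div_fin {s : ℕ} (l : ℕ) (j : Fin s) : (s * l + j) / s = l := by
  rw [Nat.mul_add_div j.pos, Nat.div_eq_of_lt j.isLt, add_zero]

theorem mul_add_mod_fin {s : ℕ} (l : ℕ) (j : Fin s) : (s * l + j) % s = j := by
  rw [Nat.mul_add_mod, Nat.mod_eq_of_lt j.isLt]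

/-- Place `⟨i, l⟩` copies `p l` exactly when `l` belongs to component `i`; the entry 0 lists no
ball. Reordering with such padding keeps the read position at most the write position, hence
causality; the next two conversions work alike. -/
theorem openOf_tupleToSeq {s : ℕ} (p : Baire) (i : Fin s) :
    openOf X (seqComp (tupleToSeq s p) i) = openOf X (finComp s p i) := by
  ext x
  simp only [SetLike.mem_coe, mem_openOf, seqComp, tupleToSeq, finComp, Nat.unpair_pair]
  constructor
  · rintro ⟨l, m, h, hx⟩
    split_ifs at h with hl
    refine ⟨l / s, m, ?_, hx⟩
    rw [← h, ← hl, Nat.div_add_mod]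
  · rintro ⟨l, m, h, hx⟩
    refine ⟨s * l + i, m, ?_, hx⟩
    rw [mul_add_mod_fin, if_pos rfl, h]

theorem openOf_wordToTuple {s : ℕ} (p : Baire) (i : Fin s) :
    openOf X (finComp s (wordToTuple s p) i) = openOf X (seqComp (fun j => p (j + 1)) i) := by
  ext x
  simp only [SetLike.mem_coe, mem_openOf, seqComp, wordToTuple, finComp, mul_add_div_fin,
    mul_add_mod_fin]
  constructor
  · rintro ⟨l, m, h, hx⟩
    split_ifs at h with hl
    refine ⟨(l - 1).unpair.2, m, ?_, hx⟩
    rw [← hl.2, Nat.pair_unpair, Nat.sub_add_cancel hl.1, h]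
  · rintro ⟨l, m, h, hx⟩
    -- The shift by one skips the length stored at place 0 of a word's name.
    refine ⟨Nat.pair i l + 1, m, ?_, hx⟩
    rw [if_pos (by simp), h]

theorem mem_openOf_groupName {s k : ℕ} {G : ℕ → ℕ} {p : Baire} {j : Fin s} {x : X} :
    x ∈ openOf X (finComp s (groupName s k G p) j) ↔
      ∃ i < k, G i = j ∧ x ∈ openOf X (seqComp p i) := by
  simp only [mem_openOf, seqComp, groupName, finComp, mul_add_div_fin, mul_add_mod_fin]
  constructor
  · rintro ⟨l, m, h, hx⟩
    split_ifs at h with hl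
    exact ⟨l.unpair.1, hl.1, hl.2, l.unpair.2, m, by rw [Nat.pair_unpair, h], hx⟩
  · rintro ⟨i, hi, hj, l, m, h, hx⟩
    exact ⟨Nat.pair i l, m, by rw [if_pos (by simp [hi, hj]), h], hx⟩

/-- With `f` computing the distances of the dense sequence and precision `1 / (k + 1)`, the test
verifies that the ideal ball with code `m` lies in the one with code `b`. -/
def formallyInside (f : ℕ × ℕ × ℕ → ℕ × ℕ) (k m b : ℕ) : Bool :=
  let y := f (b.unpair.1, m.unpair.1, k)
  decide ((y.1 * (k + 1) * (m.unpair.2.unpair.2 + 1) + (y.2 + 1) * (m.unpair.2.unpair.2 + 1) +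
      (m.unpair.2.unpair.1 + 1) * (y.2 + 1) * (k + 1)) * (b.unpair.2.unpair.2 + 1) <
    (b.unpair.2.unpair.1 + 1) * (y.2 + 1) * (k + 1) * (m.unpair.2.unpair.2 + 1))

/-- Clearing denominators turns the rational inequality into the natural number test. -/
theorem formallyInside_iff (f : ℕ × ℕ × ℕ → ℕ × ℕ) (k m b : ℕ) :
    formallyInside f k m b = true ↔
      ((f (b.unpair.1, m.unpair.1, k)).1 : ℝ) / (((f (b.unpair.1, m.unpair.1, k)).2 : ℝ) + 1) +
        1 / ((k : ℝ) + 1) + (posRat m.unpair.2 : ℝ) < (posRat b.unpair.2 : ℝ) := by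
  simp only [formallyInside, decide_eq_true_eq, posRat]
  push_cast
  generalize f (b.unpair.1, m.unpair.1, k) = y
  generalize m.unpair.2.unpair.2 = m2
  generalize m.unpair.2.unpair.1 = m1
  generalize b.unpair.2.unpair.2 = b2
  generalize b.unpair.2.unpair.1 = b1
  have e : (y.1 : ℝ) / ((y.2 : ℝ) + 1) + 1 / ((k : ℝ) + 1) + ((m1 : ℝ) + 1) / ((m2 : ℝ) + 1) =
      ((y.1 : ℝ) * (k + 1) * (m2 + 1) + (y.2 + 1) * (m2 + 1) + (m1 + 1) * (y.2 + 1) * (k + 1)) /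
        ((y.2 + 1) * (k + 1) * (m2 + 1)) := by
    field_simp
  rw [e, div_lt_div_iff₀ (by positivity) (by positivity), ← Nat.cast_lt (α := ℝ)]
  push_cast
  simp only [mul_assoc]

/-- `f` computes the distances of the dense sequence. -/
def ApproximatesDist (X : Type*) [ComputableMetricSpace X] (f : ℕ × ℕ × ℕ → ℕ × ℕ) : Prop :=
  ∀ a b k : ℕ, |dist (ComputableMetricSpace.ν (X := X) a) (ComputableMetricSpace.ν b) -
    ((f (a, b, k)).1 : ℝ) / (((f (a, b, k)).2 : ℝ) + 1)| ≤ 1 / ((k : ℝ) + 1)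

theorem exists_approximatesDist (X : Type*) [ComputableMetricSpace X] :
    ∃ f, Computable f ∧ ApproximatesDist X f := by
  obtain ⟨f, hf, h⟩ := ComputableMetricSpace.dist_computable (X := X)
  refine ⟨f, hf, fun a b k => (h a b k).trans ?_⟩
  rw [div_pow, one_pow]
  refine one_div_le_one_div_of_le (by positivity) ?_
  exact_mod_cast Nat.succ_le_of_lt k.lt_two_pow_self

variable {f : ℕ × ℕ × ℕ → ℕ × ℕ}

theorem ApproximatesDist.idealBall_le (hf : ApproximatesDist X f) {k m b : ℕ}
    (h : formallyInside f k m b = true) : idealBall X m ≤ idealBall X b := by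
  rw [formallyInside_iff] at h
  have h1 := abs_le.1 (hf b.unpair.1 m.unpair.1 k)
  intro x hx
  change x ∈ Metric.ball _ _ at hx
  change x ∈ Metric.ball _ _
  rw [Metric.mem_ball] at hx ⊢
  have h2 := dist_triangle_right x (ComputableMetricSpace.ν (X := X) b.unpair.1)
    (ComputableMetricSpace.ν m.unpair.1)
  linarith [h1.1, h1.2]

theorem ApproximatesDist.exists_formallyInside (hf : ApproximatesDist X f) {a b : ℕ} {x : X}
    (ha : x ∈ idealBall X a) (hb : x ∈ idealBall X b) :
    ∃ k m, x ∈ idealBall X m ∧ formallyInside f k m a = true ∧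
      formallyInside f k m b = true := by
  change x ∈ Metric.ball _ _ at ha hb
  rw [Metric.mem_ball] at ha hb
  -- The slack must absorb four terms `1 / (t + 1)`: the distance from `x` to the new centre, the
  -- error of `f`, the precision in the test, and the new radius.
  obtain ⟨t, ht⟩ := exists_nat_one_div_lt (show (0 : ℝ) < (min
    ((posRat a.unpair.2 : ℝ) - dist x (ComputableMetricSpace.ν a.unpair.1))
    ((posRat b.unpair.2 : ℝ) - dist x (ComputableMetricSpace.ν b.unpair.1))) / 4 from
      div_pos (lt_min (by linarith) (by linarith)) (by norm_num))
  have ht0 : (0 : ℝ) < 1 / ((t : ℝ) + 1) := by positivity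
  obtain ⟨c, hc⟩ := (ComputableMetricSpace.dense (X := X)).exists_dist_lt x ht0
  have hcode : ((posRat (Nat.pair 0 t) : ℚ) : ℝ) = 1 / ((t : ℝ) + 1) := by simp [posRat]
  have inside : ∀ b : ℕ, 4 * (1 / ((t : ℝ) + 1)) <
      (posRat b.unpair.2 : ℝ) - dist x (ComputableMetricSpace.ν (X := X) b.unpair.1) →
      formallyInside f t (Nat.pair c (Nat.pair 0 t)) b = true := by
    intro b hb
    rw [formallyInside_iff]
    simp only [Nat.unpair_pair]
    rw [hcode]
    have h1 := abs_le.1 (hf b.unpair.1 c t)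
    have h2 := dist_triangle_left (ComputableMetricSpace.ν (X := X) b.unpair.1)
      (ComputableMetricSpace.ν c) x
    linarith [h1.1, h1.2]
  refine ⟨t, Nat.pair c (Nat.pair 0 t), ?_, inside a ?_, inside b ?_⟩
  · change x ∈ Metric.ball _ _
    rw [Nat.unpair_pair, hcode]
    exact hc
  · linarith [min_le_left ((posRat a.unpair.2 : ℝ) - dist x (ComputableMetricSpace.ν a.unpair.1))
      ((posRat b.unpair.2 : ℝ) - dist x (ComputableMetricSpace.ν b.unpair.1))]
  · linarith [min_le_right ((posRat a.unpair.2 : ℝ) - dist x (ComputableMetricSpace.ν a.unpair.1))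
      ((posRat b.unpair.2 : ℝ) - dist x (ComputableMetricSpace.ν b.unpair.1))]

/-- The name of the sequence with entries `U i ∩ W (G i)`, made from a name of the sequence `U`
and a name of the `s`-tuple `W`. The place `⟨i, l₁, l₂, m, k⟩` asks whether the ideal ball `m` is
seen with precision `k` to lie in the balls listed at `l₁` for `U i` and at `l₂` for `W (G i)`. -/
def meetName (f : ℕ × ℕ × ℕ → ℕ × ℕ) (s : ℕ) (G : ℕ → ℕ) (p q : Baire) : Baire := fun n =>
  let l₁ := n.unpair.2.unpair.1
  let l₂ := n.unpair.2.unpair.2.unpair.1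
  let m := n.unpair.2.unpair.2.unpair.2.unpair.1
  let k := n.unpair.2.unpair.2.unpair.2.unpair.2
  if (l₁.unpair.1 = n.unpair.1 ∧ l₂ % s = G n.unpair.1 ∧ 1 ≤ p l₁ ∧ 1 ≤ q l₂) ∧
    formallyInside f k m (p l₁ - 1) = true ∧ formallyInside f k m (q l₂ - 1) = true
  then m + 1 else 0

/-- Every listed ball lies in both sets because the test is sound; conversely each common point has
a ball around it that passes both tests. -/
theorem ApproximatesDist.openOf_meetName (hf : ApproximatesDist X f) {s : ℕ} {G : ℕ → ℕ}
    (p q : Baire) (i : ℕ) (j : Fin s) (hj : G i = j) :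
    openOf X (seqComp (meetName f s G p q) i) = openOf X (seqComp p i) ⊓ openOf X (finComp s q j) := by
  ext x
  simp only [SetLike.mem_coe, TopologicalSpace.Opens.mem_inf, mem_openOf, seqComp, meetName,
    finComp, Nat.unpair_pair]
  constructor
  · rintro ⟨e, m, h, hx⟩
    split_ifs at h with hl
    obtain ⟨⟨h1, h2, h3, h4⟩, h5, h6⟩ := hl
    obtain rfl := Nat.succ_injective h
    refine ⟨⟨e.unpair.1.unpair.2, p e.unpair.1 - 1, ?_, hf.idealBall_le h5 hx⟩,
      ⟨e.unpair.2.unpair.1 / s, q e.unpair.2.unpair.1 - 1, ?_, hf.idealBall_le h6 hx⟩⟩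
    · rw [← h1, Nat.pair_unpair, Nat.sub_add_cancel h3]
    · rw [← hj, ← h2, Nat.div_add_mod, Nat.sub_add_cancel h4]
  · rintro ⟨⟨l, a, h1, ha⟩, ⟨l', b, h2, hb⟩⟩
    obtain ⟨k, m, hx, hka, hkb⟩ := hf.exists_formallyInside ha hb
    refine ⟨Nat.pair (Nat.pair i l) (Nat.pair (s * l' + j) (Nat.pair m k)), m, ?_, hx⟩
    simp [h1, h2, hka, hkb, hj, Nat.mod_eq_of_lt j.isLt]

end Names

/-! ### Causality and computability of the operations on names -/

theorem causal_tupleToSeq (s : ℕ) : Causal fun p _ => tupleToSeq s p := by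
  intro p p' q q' n hp hq
  simp only [tupleToSeq, hp _ (Nat.unpair_right_le n)]

theorem causal_wordToTuple (s : ℕ) : Causal fun p _ => wordToTuple s p := by
  intro p p' q q' n hp hq
  simp only [wordToTuple, hp _ (Nat.div_le_self n s)]

theorem causal_groupName (s k : ℕ) (G : ℕ → ℕ) : Causal fun p _ => groupName s k G p := by
  intro p p' q q' n hp hq
  simp only [groupName, hp _ (Nat.div_le_self n s)]

theorem causal_meetName (f : ℕ × ℕ × ℕ → ℕ × ℕ) (s : ℕ) (G : ℕ → ℕ) :
    Causal (meetName f s G) := by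
  intro p p' q q' n hp hq
  have h := Nat.unpair_right_le n
  simp only [meetName, hp _ ((Nat.unpair_left_le _).trans h),
    hq _ ((Nat.unpair_left_le _).trans ((Nat.unpair_right_le _).trans h))]

/-- The `i`-th digit of `c` in base `s`. -/
def digit (s c i : ℕ) : ℕ := c / s ^ i % s

theorem primrec_pow : Primrec₂ fun a b : ℕ => a ^ b := by
  have h : Primrec fun t : ℕ × ℕ => (Nat.rec 1 (fun _ IH => IH * t.1) t.2 : ℕ) :=
    Primrec.nat_rec' Primrec.snd (Primrec.const 1) (h := fun t y => y.2 * t.1)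
      (Primrec.nat_mul.comp (Primrec.snd.comp Primrec.snd) (Primrec.fst.comp Primrec.fst))
  refine h.of_eq fun t => ?_
  induction t.2 with
  | zero => rfl
  | succ n ih => simp only [ih, pow_succ]

theorem primrec_digit (s : ℕ) : Primrec₂ (digit s) :=
  Primrec.nat_mod.comp (Primrec.nat_div.comp Primrec.fst
    (primrec_pow.comp (Primrec.const s) Primrec.snd)) (Primrec.const s)

theorem computable_formallyInside {f : ℕ × ℕ × ℕ → ℕ × ℕ} (hf : Computable f) :
    Computable fun t : ℕ × ℕ × ℕ => formallyInside f t.1 t.2.1 t.2.2 := by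
  have u₁ {α : Type} [Primcodable α] {g : α → ℕ} (hg : Primrec g) :
      Primrec fun a => (g a).unpair.1 := Primrec.fst.comp (Primrec.unpair.comp hg)
  have u₂ {α : Type} [Primcodable α] {g : α → ℕ} (hg : Primrec g) :
      Primrec fun a => (g a).unpair.2 := Primrec.snd.comp (Primrec.unpair.comp hg)
  have hk : Primrec fun t : ℕ × ℕ × ℕ => t.1 := Primrec.fst
  have hm : Primrec fun t : ℕ × ℕ × ℕ => t.2.1 := Primrec.fst.comp Primrec.snd
  have hb : Primrec fun t : ℕ × ℕ × ℕ => t.2.2 := Primrec.snd.comp Primrec.snd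
  have hy : Computable fun t : ℕ × ℕ × ℕ => f (t.2.2.unpair.1, t.2.1.unpair.1, t.1) :=
    hf.comp ((u₁ hb).pair ((u₁ hm).pair hk)).to_comp
  -- The value of `f` becomes a separate argument, which makes the remaining arithmetic primitive
  -- recursive.
  have y₁ : Primrec fun t : (ℕ × ℕ) × ℕ × ℕ × ℕ => t.1.1 := Primrec.fst.comp Primrec.fst
  have y₂ : Primrec fun t : (ℕ × ℕ) × ℕ × ℕ × ℕ => t.1.2 + 1 :=
    Primrec.succ.comp (Primrec.snd.comp Primrec.fst)
  have hk' : Primrec fun t : (ℕ × ℕ) × ℕ × ℕ × ℕ => t.2.1 + 1 :=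
    Primrec.succ.comp (hk.comp Primrec.snd)
  have m₁ : Primrec fun t : (ℕ × ℕ) × ℕ × ℕ × ℕ => t.2.2.1.unpair.2.unpair.1 + 1 :=
    Primrec.succ.comp (u₁ (u₂ (hm.comp Primrec.snd)))
  have m₂ : Primrec fun t : (ℕ × ℕ) × ℕ × ℕ × ℕ => t.2.2.1.unpair.2.unpair.2 + 1 :=
    Primrec.succ.comp (u₂ (u₂ (hm.comp Primrec.snd)))
  have b₁ : Primrec fun t : (ℕ × ℕ) × ℕ × ℕ × ℕ => t.2.2.2.unpair.2.unpair.1 + 1 :=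
    Primrec.succ.comp (u₁ (u₂ (hb.comp Primrec.snd)))
  have b₂ : Primrec fun t : (ℕ × ℕ) × ℕ × ℕ × ℕ => t.2.2.2.unpair.2.unpair.2 + 1 :=
    Primrec.succ.comp (u₂ (u₂ (hb.comp Primrec.snd)))
  have mul {α : Type} [Primcodable α] {g g' : α → ℕ} (hg : Primrec g) (hg' : Primrec g') :
      Primrec fun a => g a * g' a := Primrec.nat_mul.comp hg hg'
  have add {α : Type} [Primcodable α] {g g' : α → ℕ} (hg : Primrec g) (hg' : Primrec g') :
      Primrec fun a => g a + g' a := Primrec.nat_add.comp hg hg'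
  have test := (Primrec.nat_lt.comp
    (mul (add (add (mul (mul y₁ hk') m₂) (mul y₂ m₂)) (mul (mul m₁ y₂) hk')) b₂)
    (mul (mul (mul b₁ y₂) hk') m₂)).decide.to_comp
  refine (test.comp (hy.pair Computable.id)).of_eq fun t => ?_
  simp only [formallyInside, id_eq]

/-- A word function that turns a name of a sequence of `k` open sets into a name of a shrinking of
it, by applying `h` to the cover grouped according to the digits of `c` in base `s`. -/
def stepWord (f : ℕ × ℕ × ℕ → ℕ × ℕ) (h : List ℕ → List ℕ) (s k c : ℕ) (w : List ℕ) : List ℕ :=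
  wordMap (meetName f s (digit s c)) w
    (h (wordMap (fun p _ => groupName s k (digit s c) p) w w))

/-- The successive application of the steps with the numbers below a bound. -/
def iterWord (f : ℕ × ℕ × ℕ → ℕ × ℕ) (h : List ℕ → List ℕ) (s k : ℕ) (w : List ℕ) (n : ℕ) :
    List ℕ :=
  Nat.rec w (fun c v => stepWord f h s k c v) n

/-- The word function that applies the steps for all groupings of the members of a finite cover
into `s` classes. -/
def shrinkWord (f : ℕ × ℕ × ℕ → ℕ × ℕ) (h : List ℕ → List ℕ) (s : ℕ) (w : List ℕ) : List ℕ :=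
  Option.casesOn w.head? [] fun k => k :: iterWord f h s k w.tail (s ^ k)

section Computability

variable {f : ℕ × ℕ × ℕ → ℕ × ℕ} {h : List ℕ → List ℕ}

theorem computable_wordMap_groupName (s : ℕ) :
    Computable fun a : (ℕ × ℕ) × List ℕ × List ℕ =>
      wordMap (fun p _ => groupName s a.1.1 (digit s a.1.2) p) a.2.1 a.2.2 := by
  refine computable_wordMap
    (Ψ := fun (a : ℕ × ℕ) p _ => groupName s a.1 (digit s a.2) p) (Primrec.to_comp ?_)
  have hn : Primrec fun t : ((ℕ × ℕ) × List ℕ × List ℕ) × ℕ => t.2 := Primrec.snd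
  have ha : Primrec fun t : ((ℕ × ℕ) × List ℕ × List ℕ) × ℕ => t.1.1 :=
    Primrec.fst.comp Primrec.fst
  have hu : Primrec fun t : ((ℕ × ℕ) × List ℕ × List ℕ) × ℕ => t.1.2.1 :=
    Primrec.fst.comp (Primrec.snd.comp Primrec.fst)
  have hd : Primrec fun t : ((ℕ × ℕ) × List ℕ × List ℕ) × ℕ => t.2 / s :=
    Primrec.nat_div.comp hn (Primrec.const s)
  have hi : Primrec fun t : ((ℕ × ℕ) × List ℕ × List ℕ) × ℕ => (t.2 / s).unpair.1 :=
    Primrec.fst.comp (Primrec.unpair.comp hd)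
  exact Primrec.ite (PrimrecPred.and (Primrec.nat_lt.comp hi (Primrec.fst.comp ha))
    (Primrec.eq.comp ((primrec_digit s).comp (Primrec.snd.comp ha) hi)
      (Primrec.nat_mod.comp hn (Primrec.const s))))
    ((Primrec.list_getD 0).comp hu hd) (Primrec.const 0)

theorem computable_wordMap_meetName (hf : Computable f) (s : ℕ) :
    Computable fun a : ℕ × List ℕ × List ℕ =>
      wordMap (meetName f s (digit s a.1)) a.2.1 a.2.2 := by
  refine computable_wordMap (Ψ := fun c => meetName f s (digit s c)) ?_
  have hn : Primrec fun t : (ℕ × List ℕ × List ℕ) × ℕ => t.2 := Primrec.snd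
  have hc : Primrec fun t : (ℕ × List ℕ × List ℕ) × ℕ => t.1.1 :=
    Primrec.fst.comp Primrec.fst
  have hu : Primrec fun t : (ℕ × List ℕ × List ℕ) × ℕ => t.1.2.1 :=
    Primrec.fst.comp (Primrec.snd.comp Primrec.fst)
  have hv : Primrec fun t : (ℕ × List ℕ × List ℕ) × ℕ => t.1.2.2 :=
    Primrec.snd.comp (Primrec.snd.comp Primrec.fst)
  have hi : Primrec fun t : (ℕ × List ℕ × List ℕ) × ℕ => t.2.unpair.1 :=
    Primrec.fst.comp (Primrec.unpair.comp hn)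
  have he : Primrec fun t : (ℕ × List ℕ × List ℕ) × ℕ => t.2.unpair.2 :=
    Primrec.snd.comp (Primrec.unpair.comp hn)
  have h₁ : Primrec fun t : (ℕ × List ℕ × List ℕ) × ℕ => t.2.unpair.2.unpair.1 :=
    Primrec.fst.comp (Primrec.unpair.comp he)
  have he' : Primrec fun t : (ℕ × List ℕ × List ℕ) × ℕ => t.2.unpair.2.unpair.2 :=
    Primrec.snd.comp (Primrec.unpair.comp he)
  have h₂ : Primrec fun t : (ℕ × List ℕ × List ℕ) × ℕ => t.2.unpair.2.unpair.2.unpair.1 :=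
    Primrec.fst.comp (Primrec.unpair.comp he')
  have he'' : Primrec fun t : (ℕ × List ℕ × List ℕ) × ℕ => t.2.unpair.2.unpair.2.unpair.2 :=
    Primrec.snd.comp (Primrec.unpair.comp he')
  have hm : Primrec fun t : (ℕ × List ℕ × List ℕ) × ℕ =>
      t.2.unpair.2.unpair.2.unpair.2.unpair.1 := Primrec.fst.comp (Primrec.unpair.comp he'')
  have hk : Primrec fun t : (ℕ × List ℕ × List ℕ) × ℕ =>
      t.2.unpair.2.unpair.2.unpair.2.unpair.2 := Primrec.snd.comp (Primrec.unpair.comp he'')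
  have hp := (Primrec.list_getD 0).comp hu h₁
  have hq := (Primrec.list_getD 0).comp hv h₂
  have test := (PrimrecPred.and
    (Primrec.eq.comp (Primrec.fst.comp (Primrec.unpair.comp h₁)) hi)
    (PrimrecPred.and
      (Primrec.eq.comp (Primrec.nat_mod.comp h₂ (Primrec.const s)) ((primrec_digit s).comp hc hi))
      (PrimrecPred.and (Primrec.nat_le.comp (Primrec.const 1) hp)
        (Primrec.nat_le.comp (Primrec.const 1) hq)))).decide.to_comp
  have inside := computable_formallyInside hf
  have test₁ := inside.comp (hk.pair (hm.pair (Primrec.nat_sub.comp hp (Primrec.const 1)))).to_comp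
  have test₂ := inside.comp (hk.pair (hm.pair (Primrec.nat_sub.comp hq (Primrec.const 1)))).to_comp
  refine (Computable.cond (Primrec.and.to_comp.comp test (Primrec.and.to_comp.comp test₁ test₂))
    (Primrec.succ.comp hm).to_comp (Computable.const 0)).of_eq fun t => ?_
  simp only [meetName, Bool.cond_eq_ite, Bool.and_eq_true, decide_eq_true_eq, Nat.succ_eq_add_one]

theorem computable_stepWord (hf : Computable f) (hh : Computable h) (s : ℕ) :
    Computable fun a : (ℕ × ℕ) × List ℕ => stepWord f h s a.1.1 a.1.2 a.2 := by
  have h₀ : Computable fun a : (ℕ × ℕ) × List ℕ => (a.1, a.2, a.2) :=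
    Computable.fst.pair (Computable.snd.pair Computable.snd)
  have h₁ : Computable fun a : (ℕ × ℕ) × List ℕ =>
      wordMap (fun p _ => groupName s a.1.1 (digit s a.1.2) p) a.2 a.2 :=
    ((computable_wordMap_groupName s).comp h₀).of_eq fun a => by simp only
  have h₂ : Computable fun a : (ℕ × ℕ) × List ℕ =>
      (a.1.2, a.2, h (wordMap (fun p _ => groupName s a.1.1 (digit s a.1.2) p) a.2 a.2)) :=
    (Computable.snd.comp Computable.fst).pair (Computable.snd.pair (hh.comp h₁))
  exact ((computable_wordMap_meetName hf s).comp h₂).of_eq fun a => by simp only [stepWord]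

theorem computable_iterWord (hf : Computable f) (hh : Computable h) (s : ℕ) :
    Computable fun a : (ℕ × List ℕ) × ℕ => iterWord f h s a.1.1 a.1.2 a.2 := by
  have h₁ : Computable fun t : ((ℕ × List ℕ) × ℕ) × ℕ × List ℕ =>
      ((t.1.1.1, t.2.1), t.2.2) :=
    ((Computable.fst.comp (Computable.fst.comp Computable.fst)).pair
        (Computable.fst.comp Computable.snd)).pair (Computable.snd.comp Computable.snd)
  have h₂ : Computable₂ fun (a : (ℕ × List ℕ) × ℕ) (y : ℕ × List ℕ) =>
      stepWord f h s a.1.1 y.1 y.2 :=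
    ((computable_stepWord hf hh s).comp h₁).of_eq fun t => by simp only
  exact (Computable.nat_rec Computable.snd (Computable.snd.comp Computable.fst) h₂).of_eq
    fun a => by simp only [iterWord]

theorem computable_shrinkWord (hf : Computable f) (hh : Computable h) (s : ℕ) :
    Computable (shrinkWord f h s) := by
  have h₁ : Computable fun t : List ℕ × ℕ => ((t.2, t.1.tail), s ^ t.2) :=
    (Computable.snd.pair (Primrec.list_tail.to_comp.comp Computable.fst)).pair
      (primrec_pow.to_comp.comp (Computable.const s) Computable.snd)
  have h₂ : Computable fun t : List ℕ × ℕ => iterWord f h s t.2 t.1.tail (s ^ t.2) :=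
    ((computable_iterWord hf hh s).comp h₁).of_eq fun t => by simp only
  have h₃ : Computable₂ fun (w : List ℕ) (k : ℕ) => k :: iterWord f h s k w.tail (s ^ k) :=
    Computable.list_cons.comp Computable.snd h₂
  exact (Computable.option_casesOn Primrec.list_head?.to_comp (Computable.const []) h₃).of_eq
    fun w => by simp only [shrinkWord]

theorem computable_wordMap_tupleToSeq (s : ℕ) :
    Computable fun w : List ℕ => wordMap (fun p _ => tupleToSeq s p) w w := by
  have hn : Primrec fun t : (Unit × List ℕ × List ℕ) × ℕ => t.2.unpair := Primrec.unpair.comp .snd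
  exact (computable_wordMap (Ψ := fun (_ : Unit) p _ => tupleToSeq s p)
    (Primrec.to_comp (Primrec.ite
      (Primrec.eq.comp (Primrec.nat_mod.comp (Primrec.snd.comp hn) (Primrec.const s))
        (Primrec.fst.comp hn))
      ((Primrec.list_getD 0).comp (Primrec.fst.comp (Primrec.snd.comp Primrec.fst))
        (Primrec.snd.comp hn)) (Primrec.const 0)))).comp
    ((Computable.const ()).pair (Computable.id.pair Computable.id))

theorem computable_wordMap_wordToTuple (s : ℕ) :
    Computable fun w : List ℕ => wordMap (fun p _ => wordToTuple s p) w w := by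
  have hd : Primrec fun t : (Unit × List ℕ × List ℕ) × ℕ => t.2 / s :=
    Primrec.nat_div.comp Primrec.snd (Primrec.const s)
  exact (computable_wordMap (Ψ := fun (_ : Unit) p _ => wordToTuple s p)
    (Primrec.to_comp (Primrec.ite
      (PrimrecPred.and (Primrec.nat_le.comp (Primrec.const 1) hd)
        (Primrec.eq.comp (Primrec.fst.comp (Primrec.unpair.comp
          (Primrec.nat_sub.comp hd (Primrec.const 1))))
          (Primrec.nat_mod.comp Primrec.snd (Primrec.const s))))
      ((Primrec.list_getD 0).comp (Primrec.fst.comp (Primrec.snd.comp Primrec.fst)) hd)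
      (Primrec.const 0)))).comp
    ((Computable.const ()).pair (Computable.id.pair Computable.id))

end Computability

/-! ### Monotonicity of the shrinking word functions -/

section Monotonicity

variable (f : ℕ × ℕ × ℕ → ℕ × ℕ) {h : List ℕ → List ℕ}

theorem stepWord_mono (hmono : ∀ u v, u <+: v → h u <+: h v)
    (s k c : ℕ) {u v : List ℕ} (huv : u <+: v) :
    stepWord f h s k c u <+: stepWord f h s k c v :=
  (causal_meetName f s _).wordMap_mono huv
    (hmono _ _ ((causal_groupName s k _).wordMap_mono huv huv))

theorem iterWord_mono (hmono : ∀ u v, u <+: v → h u <+: h v)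
    (s k n : ℕ) {u v : List ℕ} (huv : u <+: v) :
    iterWord f h s k u n <+: iterWord f h s k v n := by
  induction n with
  | zero => exact huv
  | succ c ih => exact stepWord_mono f hmono s k c ih

theorem shrinkWord_mono (hmono : ∀ u v, u <+: v → h u <+: h v)
    (s : ℕ) (u v : List ℕ) (huv : u <+: v) :
    shrinkWord f h s u <+: shrinkWord f h s v := by
  cases u with
  | nil => exact List.nil_prefix
  | cons k u =>
    -- Both words start with the same `k`, so the same number of steps is applied to their tails.
    obtain ⟨t, rfl⟩ := huv
    exact (List.prefix_cons_inj k).2 (iterWord_mono f hmono s k _ (List.prefix_append u t))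

end Monotonicity

/-! ### Realisers in terms of names, and the three equivalences -/

section Realisers

variable {X : Type*} [ComputableMetricSpace X]

theorem mem_pow_openRep {n : ℕ} {p : Baire} {U : Fin n → TopologicalSpace.Opens X} :
    U ∈ ((openRep X).pow n).toFun p ↔ (fun i => openOf X (finComp n p i)) = U :=
  ⟨fun h => h.2, fun h => ⟨fun _ => trivial, h⟩⟩

theorem mem_pow_closedRep {n : ℕ} {p : Baire} {B : Fin n → TopologicalSpace.Closeds X} :
    B ∈ ((closedRep X).pow n).toFun p ↔ (fun i => (openOf X (finComp n p i)).compl) = B :=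
  ⟨fun h => h.2, fun h => ⟨fun _ => trivial, h⟩⟩

theorem mem_star_openRep {p : Baire} {U : Words (TopologicalSpace.Opens X)} :
    U ∈ (openRep X).star.toFun p ↔
      (⟨p 0, fun i => openOf X (seqComp (fun j => p (j + 1)) i)⟩ : Words _) = U :=
  ⟨fun h => h.2, fun h => ⟨fun _ => trivial, h⟩⟩

/-- A realiser of `C`, in terms of names. -/
theorem isRealiser_opC_iff {N : ℕ} {F : Baire →. Baire} :
    IsRealiser ((openRep X).pow (N + 2)) ((openRep X).pow (N + 2)) F (opC X N) ↔
      ∀ p, (∀ x : X, ∃ j, x ∈ openOf X (finComp (N + 2) p j)) → ∃ q ∈ F p,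
        (∀ j, openOf X (finComp (N + 2) q j) ≤ openOf X (finComp (N + 2) p j)) ∧
        (∀ x : X, ∃ j, x ∈ openOf X (finComp (N + 2) q j)) ∧
        ∀ x : X, ∃ j, x ∉ openOf X (finComp (N + 2) q j) := by
  simp only [IsRealiser, mem_pow_openRep, opC, Set.mem_ofPred_eq, Set.eq_univ_iff_forall,
    Set.eq_empty_iff_forall_notMem, Set.mem_iUnion, Set.mem_iInter, not_forall]
  constructor
  · intro H p hp
    obtain ⟨q, hq, _, rfl, h⟩ := H p _ rfl hp
    exact ⟨q, hq, h⟩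
  · rintro H p _ rfl hp
    obtain ⟨q, hq, h⟩ := H p hp
    exact ⟨q, hq, _, rfl, h⟩

/-- Taking complements reverses inclusions and swaps the covering condition with the empty
intersection, while the names stay the same. -/
theorem isRealiser_opD_iff {N : ℕ} {F : Baire →. Baire} :
    IsRealiser ((closedRep X).pow (N + 2)) ((closedRep X).pow (N + 2)) F (opD X N) ↔
      IsRealiser ((openRep X).pow (N + 2)) ((openRep X).pow (N + 2)) F (opC X N) := by
  rw [isRealiser_opC_iff]
  simp only [IsRealiser, mem_pow_closedRep, opD, Set.mem_ofPred_eq, Set.eq_univ_iff_forall,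
    Set.eq_empty_iff_forall_notMem, Set.mem_iUnion, Set.mem_iInter, not_forall]
  have sub : ∀ p q : Baire, ((openOf X p).compl : Set X) ⊆ (openOf X q).compl ↔
      openOf X q ≤ openOf X p := fun p q => Set.compl_subset_compl
  constructor
  · intro H p hp
    obtain ⟨q, hq, _, rfl, h₁, h₂, h₃⟩ := H p _ rfl fun x => (hp x).imp fun j hj => not_not.2 hj
    exact ⟨q, hq, fun j => (sub _ _).1 (h₁ j), fun x => (h₃ x).imp fun j hj => not_not.1 hj, h₂⟩
  · rintro H p _ rfl hp
    obtain ⟨q, hq, h₁, h₂, h₃⟩ := H p fun x => (hp x).imp fun j hj => not_not.1 hj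
    exact ⟨q, hq, _, rfl, fun j => (sub _ _).2 (h₁ j), h₃,
      fun x => (h₂ x).imp fun j hj => not_not.2 hj⟩

theorem isComputable_opC_iff_opD (N : ℕ) :
    IsComputable ((openRep X).pow (N + 2)) ((openRep X).pow (N + 2)) (opC X N) ↔
      IsComputable ((closedRep X).pow (N + 2)) ((closedRep X).pow (N + 2)) (opD X N) := by
  simp only [IsComputable, isRealiser_opD_iff]

theorem order_le_iff {Y I : Type*} {A : I → Set Y} {n : ℕ} :
    order A ≤ n ↔ ∀ i : Fin (n + 1) → I, Function.Injective i → ⋂ j, A (i j) = ∅ := by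
  constructor
  · intro h i hi
    by_contra hne
    refine absurd h (not_le.2 ?_)
    -- If the condition fails at `n`, every admissible `m` is at least `n + 1`: for `m ≤ n`, the
    -- first `m + 1` of the given indices would already have empty intersection.
    refine lt_of_lt_of_le (b := ((n + 1 : ℕ) : ℕ∞)) (by exact_mod_cast n.lt_succ_self)
      (le_iInf₂ fun m hm => ?_)
    by_contra hmn
    have hmn : m + 1 ≤ n + 1 := by
      have : m < n + 1 := by exact_mod_cast not_le.1 hmn
      omega
    refine hne (Set.subset_empty_iff.1 ?_)
    rw [← hm (fun j => i (Fin.castLE hmn j)) (hi.comp (Fin.castLE_injective hmn))]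
    exact Set.subset_iInter fun j => Set.iInter_subset _ _
  · exact fun h => iInf₂_le n h

theorem isComputable_opC_of_opCstar {N : ℕ}
    (H : IsComputable (openRep X).star (openRep X).star (opCstar X N)) :
    IsComputable ((openRep X).pow (N + 2)) ((openRep X).pow (N + 2)) (opC X N) := by
  obtain ⟨F, ⟨h, hc, hmono, hF⟩, hreal⟩ := H
  let s := N + 2
  let T₁ : List ℕ → List ℕ := fun w => s :: wordMap (fun p _ => tupleToSeq s p) w w
  let T₂ : List ℕ → List ℕ := fun w => wordMap (fun p _ => wordToTuple s p) w w
  have hT₁ : ∀ u v, u <+: v → T₁ u <+: T₁ v := fun u v huv =>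
    (List.prefix_cons_inj s).2 ((causal_tupleToSeq s).wordMap_mono huv huv)
  have hcomp : Computable fun w => T₂ (h (T₁ w)) :=
    (computable_wordMap_wordToTuple s).comp (hc.comp
      (Computable.list_cons.comp (Computable.const s) (computable_wordMap_tupleToSeq s)))
  obtain ⟨G, hG, hGspec⟩ := exists_computableFun hcomp fun u v huv =>
    (causal_wordToTuple s).wordMap_mono (hmono _ _ (hT₁ u v huv)) (hmono _ _ (hT₁ u v huv))
  refine ⟨G, hG, isRealiser_opC_iff.2 fun p hp => ?_⟩
  let p' : Baire := fun n => Nat.casesOn n s (tupleToSeq s p)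
  have hp' : ∀ i : Fin s, openOf X (seqComp (fun j => p' (j + 1)) i) = openOf X (finComp s p i) :=
    fun i => openOf_tupleToSeq p i
  obtain ⟨q, hq, t, ht, W, rfl, ⟨hsub, hcov⟩, hord⟩ := hreal p' _ (mem_star_openRep.2 rfl) (by
    refine Set.eq_univ_iff_forall.2 fun x => Set.mem_iUnion.2 ?_
    obtain ⟨i, hi⟩ := hp x
    exact ⟨i, by rw [← hp'] at hi; exact hi⟩)
  rw [mem_star_openRep] at ht
  have hW : ∀ i : Fin s, W i = openOf X (seqComp (fun j => q (j + 1)) i) := by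
    -- The output length `q 0` must become a variable before the equality of words can identify it
    -- with `s` and the letters can be compared.
    generalize hk : q 0 = k at ht
    obtain ⟨rfl, h2⟩ := Sigma.mk.inj_iff.1 ht
    exact fun i => (congrFun (eq_of_heq h2) i).symm
  have hex : Exhausts (fun m => T₁ (initSeg p m)) p' := by
    refine ⟨fun m n hmn => hT₁ _ _ (initSeg_mono p hmn), fun n => ⟨n, ?_⟩⟩
    refine (initSeg_mono p' n.le_succ).trans ?_
    rw [Nat.succ_eq_add_one, initSeg_succ]
    exact (List.prefix_cons_inj s).2 (by
      rw [(causal_tupleToSeq s).wordMap_initSeg p p n])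
  have hex' := hex.comp hmono ((hF p' q).1 hq)
  refine ⟨_, hGspec p _ ((causal_wordToTuple s).exhausts hex' hex'), ?_⟩
  have hout : ∀ i : Fin s, openOf X (finComp s (wordToTuple s q) i) = W i :=
    fun i => (openOf_wordToTuple q i).trans (hW i).symm
  refine ⟨fun j => (hout j).trans_le ?_, fun x => ?_, fun x => ?_⟩
  · rw [← hp']
    exact hsub j
  · obtain ⟨j, hj⟩ := Set.mem_iUnion.1 (Set.eq_univ_iff_forall.1 hcov x)
    exact ⟨j, (hout j).symm ▸ hj⟩
  -- The identity lists all `N + 2` indices, so the order bound kills the full intersection.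
  · have := (order_le_iff (n := N + 1)).1 (by exact_mod_cast hord) (id : Fin s → Fin s)
      Function.injective_id
    by_contra hx
    push Not at hx
    exact Set.eq_empty_iff_forall_notMem.1 this x
      (Set.mem_iInter.2 fun j => (hout j) ▸ hx j)

/-- Base `s` expansion: the numbers below `s ^ k` enumerate all groupings of `k` members into `s`
classes. -/
theorem exists_digit_eq (s k : ℕ) (g : Fin k → Fin s) :
    ∃ c < s ^ k, ∀ i : Fin k, digit s c i = g i := by
  refine ⟨finFunctionFinEquiv g, (finFunctionFinEquiv g).isLt, fun i => ?_⟩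
  exact congrArg Fin.val (congrFun (finFunctionFinEquiv.symm_apply_apply g) i)

theorem digit_lt {s : ℕ} (hs : 0 < s) (c i : ℕ) : digit s c i < s := Nat.mod_lt _ hs

/-- The effect of the steps with numbers below `n` on a name `r` of a cover with `k` members. -/
theorem exists_exhausts_iterWord {N : ℕ} {f : ℕ × ℕ × ℕ → ℕ × ℕ} (hf : ApproximatesDist X f)
    {F : Baire →. Baire} {h : List ℕ → List ℕ} (hmono : ∀ u v, u <+: v → h u <+: h v)
    (hF : ∀ p q : Baire, q ∈ F p ↔ ∀ n, ∃ m, initSeg q n <+: h (initSeg p m))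
    (hreal : IsRealiser ((openRep X).pow (N + 2)) ((openRep X).pow (N + 2)) F (opC X N))
    {k : ℕ} {r : Baire} (hr : ∀ x : X, ∃ i < k, x ∈ openOf X (seqComp r i)) (n : ℕ) :
    ∃ q, Exhausts (fun m => iterWord f h (N + 2) k (initSeg r m) n) q ∧
      (∀ i, openOf X (seqComp q i) ≤ openOf X (seqComp r i)) ∧
      (∀ x : X, ∃ i < k, x ∈ openOf X (seqComp q i)) ∧
      ∀ c < n, ∀ a : Fin (N + 2) → ℕ, (∀ j, digit (N + 2) c (a j) = j) →
        ∀ x : X, ∃ j, x ∉ openOf X (seqComp q (a j)) := by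
  induction n with
  | zero => exact ⟨r, exhausts_initSeg r, fun _ => le_rfl, hr, fun c hc => absurd hc c.not_lt_zero⟩
  | succ n ih =>
    obtain ⟨q, hex, hsub, hcov, hord⟩ := ih
    have hgroup := (causal_groupName (N + 2) k (digit (N + 2) n)).exhausts hex hex
    obtain ⟨v, hv, hvsub, hvcov, hvord⟩ := isRealiser_opC_iff.1 hreal
      (groupName (N + 2) k (digit (N + 2) n) q) fun x => by
        obtain ⟨i, hi, hx⟩ := hcov x
        exact ⟨⟨digit (N + 2) n i, digit_lt (by omega) n i⟩,
          mem_openOf_groupName.2 ⟨i, hi, rfl, hx⟩⟩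
    have meet := hf.openOf_meetName (s := N + 2) (G := digit (N + 2) n) q v
    have hle : ∀ i, openOf X (seqComp (meetName f (N + 2) (digit (N + 2) n) q v) i) ≤
        openOf X (seqComp q i) := fun i => by
      rw [meet i ⟨digit (N + 2) n i, digit_lt (by omega) n i⟩ rfl]
      exact inf_le_left
    refine ⟨_, (causal_meetName f (N + 2) _).exhausts hex
      (hgroup.comp hmono ((hF _ v).1 hv)), fun i => (hle i).trans (hsub i), fun x => ?_,
      fun c hc a ha x => ?_⟩
    -- A point of `v j` lies in the `j`-th group, hence in a member of that class, whose replacement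
    -- still contains it.
    · obtain ⟨j, hj⟩ := hvcov x
      obtain ⟨i, hi, hij, hx⟩ := mem_openOf_groupName.1 (hvsub j hj)
      exact ⟨i, hi, by rw [meet i j hij]; exact ⟨hx, hj⟩⟩
    -- Earlier groupings stay separated because sets only shrink; for the current one, member `a j`
    -- now lies in `v j`, and the `v j` have no common point.
    · rcases Nat.lt_succ_iff_lt_or_eq.1 hc with hc | rfl
      · exact (hord c hc a ha x).imp fun j hj hx => hj (hle _ hx)
      · refine (hvord x).imp fun j hj hx => hj ?_
        rw [meet (a j) j (ha j)] at hx
        exact hx.2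

theorem isComputable_opCstar_of_opC {N : ℕ}
    (H : IsComputable ((openRep X).pow (N + 2)) ((openRep X).pow (N + 2)) (opC X N)) :
    IsComputable (openRep X).star (openRep X).star (opCstar X N) := by
  obtain ⟨F, ⟨h, hc, hmono, hF⟩, hreal⟩ := H
  obtain ⟨f, hfc, hf⟩ := exists_approximatesDist X
  obtain ⟨G, hG, hGspec⟩ := exists_computableFun (computable_shrinkWord hfc hc (N + 2))
    (shrinkWord_mono f hmono (N + 2))
  refine ⟨G, hG, fun p U hU hdom => ?_⟩
  rw [mem_star_openRep] at hU
  subst hU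
  have hcover : ∀ x : X, ∃ i < p 0, x ∈ openOf X (seqComp (fun j => p (j + 1)) i) := fun x => by
    obtain ⟨i, hi⟩ := Set.mem_iUnion.1 (Set.eq_univ_iff_forall.1 hdom x)
    exact ⟨i, i.isLt, hi⟩
  obtain ⟨r, hex, hsub, hcov, hord⟩ :=
    exists_exhausts_iterWord hf hmono hF hreal hcover ((N + 2) ^ p 0)
  let q : Baire := fun n => Nat.casesOn n (p 0) r
  refine ⟨q, hGspec p q ⟨fun m n hmn => shrinkWord_mono f hmono _ _ _ (initSeg_mono p hmn),
    fun n => ?_⟩, _, mem_star_openRep.2 rfl,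
    fun i => openOf X (seqComp r i), rfl, ⟨fun i => hsub i, ?_⟩, ?_⟩
  · obtain ⟨m, hm⟩ := hex.2 n
    refine ⟨m + 1, (initSeg_mono q n.le_succ).trans ?_⟩
    beta_reduce
    rw [Nat.succ_eq_add_one, initSeg_succ, initSeg_succ]
    exact (List.prefix_cons_inj (p 0)).2 hm
  · refine Set.eq_univ_iff_forall.2 fun x => Set.mem_iUnion.2 ?_
    obtain ⟨i, hi, hx⟩ := hcov x
    exact ⟨⟨i, hi⟩, hx⟩
  · refine (order_le_iff (n := N + 1)).2 fun i hi => ?_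
    -- The grouping puts index `i j` into class `j`; indices outside the range of `i` go to an
    -- arbitrary class.
    obtain ⟨c, hc', hdig⟩ := exists_digit_eq (N + 2) (p 0) (Function.invFun i)
    refine Set.eq_empty_iff_forall_notMem.2 fun x hx => ?_
    obtain ⟨j, hj⟩ := hord c hc' (fun j => i j)
      (fun j => by rw [hdig, Function.leftInverse_invFun hi j]) x
    exact hj (Set.mem_iInter.1 hx j)

end Realisers

end CovDim

theorem theorem6p3 {X : Type*} [CovDim.ComputableMetricSpace X] (N : ℕ) :
    List.TFAE [
      CovDim.IsComputable (CovDim.openRep X).star (CovDim.openRep X).star (CovDim.opCstar X N),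
      CovDim.IsComputable ((CovDim.openRep X).pow (N + 2)) ((CovDim.openRep X).pow (N + 2))
        (CovDim.opC X N),
      CovDim.IsComputable ((CovDim.closedRep X).pow (N + 2)) ((CovDim.closedRep X).pow (N + 2))
        (CovDim.opD X N)] := by
  tfae_have 1 → 2 := CovDim.isComputable_opC_of_opCstar
  tfae_have 2 → 1 := CovDim.isComputable_opCstar_of_opC
  tfae_have 2 ↔ 3 := CovDim.isComputable_opC_iff_opD N
  tfae_finish
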